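/- Let $\Bbbk$ be an algebraically closed field with $\operatorname{char}\Bbbk\neq 2,3$ and let $n\ge 1$, $d\ge 1$. Let $V_{n,d}=\nu_d(\mathbb P^n)\subset\mathbb P^{N}$, $N=\binom{n+d}{n}-1$, be the Veronese variety, with homogeneous coordinates $z_I$ on $\mathbb P^N$ indexed by $I=(a_0,\dots,a_n)\in\mathbb N_0^{n+1}$ with $\sum_i a_i=d$, where $\nu_d([x])=[(x^I)_I]$. Then $(\mathbb P^n,\mathcal O_{\mathbb P^n}(d))$ satisfies property $\mathsf{QR}(3)$: the homogeneous ideal $I(V_{n,d})$ is generated by quadrics of rank at most $3$. More precisely, suppose $d\ge 2$. Let $f$ be the isomorphism from $H^0(\mathbb P^n,\mathcal O_{\mathbb P^n}(d))$ to the linear forms on $\mathbb P^N$ with $f(x^I)=z_I$, and for $s,t\in H^0(\mathbb P^n,\mathcal O_{\mathbb P^n}(1))$ and $h\in H^0(\mathbb P^n,\mathcal O_{\mathbb P^n}(d-2))$ put $$Q(s,t,h)=f(s^2h)\,f(t^2h)-f(sth)^2 .$$ Let $s_1,\dots,s_p$ be any basis of $H^0(\mathbb P^n,\mathcal O_{\mathbb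 P^n}(1))$, let $h_1,\dots,h_q$ be any basis of $H^0(\mathbb P^n,\mathcal O_{\mathbb P^n}(d-2))$, and let $H=\{h_i\}_{1\le i\le q}\cup\{h_i+h_j\mid 1\le i<j\le q\}$. Let $\Gamma=\Gamma(\mathcal O_{\mathbb P^n}(1),\mathcal O_{\mathbb P^n}(d-2))$ be the union of $$\begin{aligned} \Gamma_{11}&=\{Q(s_i,s_j,g)\mid i<j,\ g\in H\},\\ \Gamma_{12}&=\{Q(s_i+s_j,s_k,g)\mid i<j,\ k\neq i,j,\ g\in H\},\\ \Gamma_{22}&=\{Q(s_i+s_j,s_k+s_l,g)\mid i<j,\ k<l,\ i<k,\ j\neq k,l,\ g\in H\}. \end{aligned}$$ Then $\Gamma$ is a finite set of quadrics of rank $3$, and it generates the ideal $I(V_{n,d})$. -/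

import Mathlib

open scoped LinearAlgebra.Projectivization

namespace QuadricRank

noncomputable section

/-! ### Homogeneous ideals of projective sets, quadrics and their rank -/

/-- The homogeneous ideal `I(X)` of a subset `X` of the projective space with homogeneous
coordinates `z_i`, `i ∈ σ`: the ideal generated by the homogeneous polynomials that vanish at
(all representatives of) all points of `X`. -/
def homogeneousIdeal {k σ : Type*} [Field k] (X : Set (ℙ k (σ → k))) :
    Ideal (MvPolynomial σ k) :=
  Ideal.span {F | ∃ m : ℕ, F.IsHomogeneous m ∧
    ∀ (v : σ → k) (hv : v ≠ 0), Projectivization.mk k v hv ∈ X → MvPolynomial.eval v F = 0}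

/-- A quadric (quadratic equation): a nonzero homogeneous polynomial of degree two. -/
def IsQuadric {k σ : Type*} [Field k] (F : MvPolynomial σ k) : Prop :=
  F ≠ 0 ∧ F.IsHomogeneous 2

open scoped Classical in
/-- The symmetric matrix `M` of a quadratic form `F` in characteristic different from two,
`F(z) = ∑ i j, M i j * z i * z j`. -/
def gramMatrix {k σ : Type*} [Field k] (F : MvPolynomial σ k) : Matrix σ σ k :=
  Matrix.of fun i j =>
    if i = j then F.coeff (Finsupp.single i 2)
    else F.coeff (Finsupp.single i 1 + Finsupp.single j 1) / 2

/-- The rank of a quadric (in characteristic different from two): the rank of its symmetric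
matrix. -/
def quadricRank {k σ : Type*} [Field k] [Fintype σ] (F : MvPolynomial σ k) : ℕ :=
  (gramMatrix F).rank

/-- `X` satisfies property `QR(r)`: its homogeneous ideal can be generated by quadrics of rank at
most `r`. -/
def PropertyQR {k σ : Type*} [Field k] [Fintype σ] (r : ℕ) (X : Set (ℙ k (σ → k))) : Prop :=
  ∃ S : Set (MvPolynomial σ k),
    (∀ F ∈ S, IsQuadric F ∧ quadricRank F ≤ r) ∧ Ideal.span S = homogeneousIdeal X

/-! ### The Veronese embedding -/

/-- The set `A(n,d)` of exponent vectors `(a_0, …, a_n)` of natural numbers with sum `d`; it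
indexes the homogeneous coordinates `z_I` of the target of the `d`-th Veronese embedding. -/
abbrev Exponent (n d : ℕ) : Type :=
  {a : Fin (n + 1) →₀ ℕ // ∑ i, a i = d}

instance instFintypeExponent (n d : ℕ) : Fintype (Exponent n d) :=
  Fintype.subtype (Finset.finsuppAntidiag Finset.univ d) (by simp)

/-- The vector `(v^I)_I` of all monomials of degree `d` in the coordinates of `v`. -/
def veroneseVector (k : Type*) [Field k] (n d : ℕ) (v : Fin (n + 1) → k) : Exponent n d → k :=
  fun I => ∏ i, v i ^ (I.1 i)

theorem veroneseVector_ne_zero {k : Type*} [Field k] (n d : ℕ) (v : Fin (n + 1) → k)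
    (hv : v ≠ 0) : veroneseVector k n d v ≠ 0 := by
  obtain ⟨i, hi⟩ := Function.ne_iff.1 hv
  intro h
  have hsum : ∑ j, (Finsupp.single i d : Fin (n + 1) →₀ ℕ) j = d := by
    simp [Finsupp.single_apply]
  have h1 := congrFun h ⟨Finsupp.single i d, hsum⟩
  simp only [veroneseVector, Pi.zero_apply, Finset.prod_eq_zero_iff] at h1
  obtain ⟨j, -, hj⟩ := h1
  by_cases hji : i = j
  · subst hji
    exact hi (eq_zero_of_pow_eq_zero hj)
  · simp [hji] at hj

theorem veroneseVector_smul {k : Type*} [Field k] (n d : ℕ) (t : k) (v : Fin (n + 1) → k) :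
    veroneseVector k n d (t • v) = t ^ d • veroneseVector k n d v := by
  funext I
  simp only [veroneseVector, Pi.smul_apply, smul_eq_mul, mul_pow, Finset.prod_mul_distrib,
    Finset.prod_pow_eq_pow_sum, I.2]

/-- The `d`-th Veronese embedding `ν_d : ℙⁿ → ℙᴺ`, `[v] ↦ [(v^I)_I]`. -/
def veroneseMap (k : Type*) [Field k] (n d : ℕ) :
    ℙ k (Fin (n + 1) → k) → ℙ k (Exponent n d → k) :=
  Projectivization.lift
    (fun v => Projectivization.mk k (veroneseVector k n d v.1)
      (veroneseVector_ne_zero n d v.1 v.2))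
    (by
      intro a b t h
      rw [Projectivization.mk_eq_mk_iff']
      exact ⟨t ^ d, by rw [h, veroneseVector_smul]⟩)

/-- The Veronese variety `V_{n,d}`, the image of `ν_d`. -/
def veroneseVariety (k : Type*) [Field k] (n d : ℕ) : Set (ℙ k (Exponent n d → k)) :=
  Set.range (veroneseMap k n d)

/-! ### The map `Q` and the set `Γ` -/

/-- The space `H⁰(ℙⁿ, O(e))` of forms of degree `e` in `x_0, …, x_n`. -/
abbrev Forms (k : Type*) [Field k] (n e : ℕ) : Submodule k (MvPolynomial (Fin (n + 1)) k) :=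
  MvPolynomial.homogeneousSubmodule (Fin (n + 1)) k e

/-- The natural map `f` sending a form `F = ∑ c_I x^I` of degree `d` to the linear form
`∑ c_I z_I` on `ℙᴺ`. On `H⁰(ℙⁿ, O(d))` it is the isomorphism onto the linear forms, inverse to
restriction along `ν_d`; it is only applied to forms of degree `d`. -/
def linearForm {k : Type*} [Field k] (n d : ℕ) (F : MvPolynomial (Fin (n + 1)) k) :
    MvPolynomial (Exponent n d) k :=
  ∑ I : Exponent n d, MvPolynomial.C (F.coeff I.1) * MvPolynomial.X I

/-- `Q(s,t,h) = f(s²h) f(t²h) - f(sth)²`, for `s, t` of degree `1` and `h` of degree `d - 2`. -/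
def Q {k : Type*} [Field k] (n d : ℕ) (s t h : MvPolynomial (Fin (n + 1)) k) :
    MvPolynomial (Exponent n d) k :=
  linearForm n d (s * s * h) * linearForm n d (t * t * h) - linearForm n d (s * t * h) ^ 2

/-- The set `H = {h_i} ∪ {h_i + h_j | i < j}`. -/
def sumsOfBasis {R : Type*} [Add R] {q : ℕ} (h : Fin q → R) : Set R :=
  {g | ∃ i, g = h i} ∪ {g | ∃ i j, i < j ∧ g = h i + h j}

/-- `Γ₁₁ = {Q(s_i, s_j, g) | i < j, g ∈ H}`. -/
def Gamma11 {k : Type*} [Field k] (n d : ℕ) {p q : ℕ}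
    (s : Fin p → MvPolynomial (Fin (n + 1)) k) (h : Fin q → MvPolynomial (Fin (n + 1)) k) :
    Set (MvPolynomial (Exponent n d) k) :=
  {F | ∃ i j, i < j ∧ ∃ g ∈ sumsOfBasis h, F = Q n d (s i) (s j) g}

/-- `Γ₁₂ = {Q(s_i + s_j, s_l, g) | i < j, l ≠ i, j, g ∈ H}`. -/
def Gamma12 {k : Type*} [Field k] (n d : ℕ) {p q : ℕ}
    (s : Fin p → MvPolynomial (Fin (n + 1)) k) (h : Fin q → MvPolynomial (Fin (n + 1)) k) :
    Set (MvPolynomial (Exponent n d) k) :=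
  {F | ∃ i j l, i < j ∧ l ≠ i ∧ l ≠ j ∧ ∃ g ∈ sumsOfBasis h, F = Q n d (s i + s j) (s l) g}

/-- `Γ₂₂ = {Q(s_i + s_j, s_l + s_m, g) | i < j, l < m, i < l, j ≠ l, m, g ∈ H}`. -/
def Gamma22 {k : Type*} [Field k] (n d : ℕ) {p q : ℕ}
    (s : Fin p → MvPolynomial (Fin (n + 1)) k) (h : Fin q → MvPolynomial (Fin (n + 1)) k) :
    Set (MvPolynomial (Exponent n d) k) :=
  {F | ∃ i j l m, i < j ∧ l < m ∧ i < l ∧ j ≠ l ∧ j ≠ m ∧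
    ∃ g ∈ sumsOfBasis h, F = Q n d (s i + s j) (s l + s m) g}

/-- The set `Γ(O(1), O(d-2)) = Γ₁₁ ∪ Γ₁₂ ∪ Γ₂₂` attached to a basis `s` of `H⁰(ℙⁿ, O(1))` and a
basis `h` of `H⁰(ℙⁿ, O(d-2))`. -/
def Gamma {k : Type*} [Field k] (n d : ℕ) {p q : ℕ}
    (s : Module.Basis (Fin p) k (Forms k n 1)) (h : Module.Basis (Fin q) k (Forms k n (d - 2))) :
    Set (MvPolynomial (Exponent n d) k) :=
  Gamma11 n d (fun i => (s i).1) (fun i => (h i).1) ∪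
    Gamma12 n d (fun i => (s i).1) (fun i => (h i).1) ∪
    Gamma22 n d (fun i => (s i).1) (fun i => (h i).1)

end

end QuadricRank

/-!
Write `Y_u` for the class of `z_u` modulo the ideal spanned by `Γ`. For a fixed form `g` of degree
`d - 2`, the symmetric bilinear map `B(x, y) = f(x y g)` on linear forms has the Gram determinants
`B(x, x) B(y, y) - B(x, y)² = Q(x, y, g)`. The tensor `B(a, c) B(b, e) - B(a, e) B(b, c)` has the
symmetries of a curvature tensor, with these Gram determinants as sectional curvatures. The latter
are quadratic in `x` and in `y`, hence vanish modulo `Γ` as soon as they do on the basis vectors and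
on their sums; so all the minors vanish for `g ∈ H`. A minor is quadratic in `g`, so it vanishes for
all `g`, and its polarization in `g` relates products `Y_u Y_v` that differ by moving two
variables. These relations imply the exchange relations
`Y(x_a u) Y(x_b v) = Y(x_b u) Y(x_a v)`, whose two sides differ by an expression that is both
symmetric and antisymmetric in `u` and `v`. Exchange relations bring any two monomials in the `z_I`
with the same image under `z_I ↦ x^I` to the same form, so they generate the toric ideal
`I(V_{n,d})`.

For the rank, `Q(s, t, h)` is the pullback of the conic `x z - y²` under three linear forms, which
are independent because `s² h`, `s t h` and `t² h` are.
-/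

namespace QuadricRank

open MvPolynomial
open scoped Matrix

section QuadraticMap

variable {k W A : Type*} [CommRing k] [AddCommGroup W] [Module k W]

theorem quadraticMap_eq_zero_of_sumsOfBasis [AddCommGroup A] [Module k A] {q : ℕ}
    (h : Module.Basis (Fin q) k W) {Φ : QuadraticMap k W A}
    (hΦ : ∀ g ∈ sumsOfBasis h, Φ g = 0) : Φ = 0 := by
  have on_basis : ∀ i, Φ (h i) = 0 := fun i => hΦ _ (Or.inl ⟨i, rfl⟩)
  have on_sums : ∀ i j, i < j → Φ (h i + h j) = 0 := fun i j hij => hΦ _ (Or.inr ⟨i, j, hij, rfl⟩)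
  rw [← QuadraticMap.toQuadraticMap_toBilin Φ h]
  suffices Φ.toBilin h = 0 by rw [this]; rfl
  refine h.ext fun i => h.ext fun j => ?_
  rw [QuadraticMap.toBilin_apply]
  rcases lt_trichotomy i j with hij | rfl | hij
  · simp [hij, hij.ne, QuadraticMap.polar, on_basis, on_sums i j hij]
  · simp [on_basis]
  · simp [hij.ne', hij.not_gt]

variable [CommRing A] [Algebra k A]

/-- The Gram determinant `B(x, x) B(y, y) - B(x, y) B(y, x)` of a bilinear map with values in a
commutative algebra, as a quadratic map in `x`. -/
def gramDet (B : LinearMap.BilinMap k W A) (y : W) : QuadraticMap k W A :=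
  (LinearMap.mulRight k (B y y)).compQuadraticMap B.toQuadraticMap -
    QuadraticMap.linMulLin (B.flip y) (B y)

variable {B : LinearMap.BilinMap k W A}

theorem gramDet_apply (x y : W) : gramDet B y x = B x x * B y y - B x y * B y x := rfl

theorem gramDet_comm (x y : W) : gramDet B y x = gramDet B x y := by
  simp only [gramDet_apply]
  ring

theorem gramDet_self (x : W) : gramDet B x x = 0 := by
  rw [gramDet_apply, sub_self]

theorem gramDet_add_self (x y : W) : gramDet B y (x + y) = gramDet B y x := by
  simp only [gramDet_apply, map_add, LinearMap.add_apply]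
  ring

theorem gramDet_self_add (x y : W) : gramDet B x (x + y) = gramDet B x y := by
  rw [add_comm, gramDet_add_self]

/-- `Γ` contains no `Q` of two sums that share a basis vector: this is where they come from. -/
theorem gramDet_add_add_eq_zero (hB : ∀ x y, B x y = B y x) {a b c : W}
    (ha : gramDet B a = 0) (hb : gramDet B b = 0) (hc : gramDet B c = 0) :
    gramDet B (c + b) (c + a) = 0 := by
  have hab := DFunLike.congr_fun ha b
  have hac := DFunLike.congr_fun ha c
  have hbc := DFunLike.congr_fun hb c
  have ha' := DFunLike.congr_fun ha (b + c)
  have hb' := DFunLike.congr_fun hb (a + c)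
  have hc' := DFunLike.congr_fun hc (a + b)
  simp only [gramDet_apply, map_add, LinearMap.add_apply, hB b a, hB c a, hB c b,
    zero_apply] at *
  linear_combination ha' + hb' - hc' - hab + hac + hbc

/-- The tensor `B(a, c) B(b, d) - B(a, d) B(b, c)` has the symmetries of a curvature tensor, and is
determined by its sectional curvature `gramDet B`. -/
theorem mul_eq_mul_of_gramDet_eq_zero (h2 : IsLeftRegular (2 : A)) (h3 : IsLeftRegular (3 : A))
    (hB : ∀ x y, B x y = B y x) (h : ∀ y, gramDet B y = 0) (a b c d : W) :
    B a c * B b d = B a d * B b c := by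
  have hK : ∀ x y, B x x * B y y = B x y * B x y := fun x y => by
    have := DFunLike.congr_fun (h y) x
    rwa [gramDet_apply, hB y x, zero_apply, sub_eq_zero] at this
  have polar_left : ∀ x x' y, B x x' * B y y = B x y * B x' y := fun x x' y => h2 <| by
    have := hK (x + x') y
    simp only [map_add, LinearMap.add_apply, hB x' x] at this
    linear_combination this - hK x y - hK x' y
  have polar_right : ∀ x x' y y', 2 * (B x x' * B y y') = B x y * B x' y' + B x y' * B x' y :=
    fun x x' y y' => by
      have := polar_left x x' (y + y')
      simp only [map_add, LinearMap.add_apply, hB y' y] at this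
      linear_combination this - polar_left x x' y - polar_left x x' y'
  apply h3
  have h₁ := polar_right a c b d
  have h₂ := polar_right a d b c
  simp only [hB d b, hB c b, hB d c] at h₁ h₂
  linear_combination h₁ - h₂

theorem gramDet_basis_eq_zero {p : ℕ} (s : Module.Basis (Fin p) k W)
    (h11 : ∀ i j, i < j → gramDet B (s j) (s i) = 0)
    (h12 : ∀ i j l, i < j → l ≠ i → l ≠ j → gramDet B (s l) (s i + s j) = 0) (l : Fin p) :
    gramDet B (s l) = 0 := by
  refine quadraticMap_eq_zero_of_sumsOfBasis s ?_
  rintro _ (⟨i, rfl⟩ | ⟨i, j, hij, rfl⟩)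
  · rcases lt_trichotomy i l with hil | rfl | hil
    · exact h11 i l hil
    · exact gramDet_self _
    · rw [gramDet_comm, h11 l i hil]
  · rcases eq_or_ne l i with rfl | hli
    · rw [gramDet_self_add, gramDet_comm, h11 l j hij]
    rcases eq_or_ne l j with rfl | hlj
    · rw [gramDet_add_self, h11 i l hij]
    · exact h12 i j l hij hli hlj

theorem gramDet_eq_zero_of_basis {p : ℕ} (s : Module.Basis (Fin p) k W)
    (hB : ∀ x y, B x y = B y x)
    (h11 : ∀ i j, i < j → gramDet B (s j) (s i) = 0)
    (h12 : ∀ i j l, i < j → l ≠ i → l ≠ j → gramDet B (s l) (s i + s j) = 0)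
    (h22 : ∀ i j l m, i < j → l < m → i < l → j ≠ l → j ≠ m →
      gramDet B (s l + s m) (s i + s j) = 0) (y : W) :
    gramDet B y = 0 := by
  have basis_zero := gramDet_basis_eq_zero s h11 h12
  have share : ∀ a b c, gramDet B (s c + s b) (s c + s a) = 0 := fun a b c =>
    gramDet_add_add_eq_zero hB (basis_zero a) (basis_zero b) (basis_zero c)
  have sum_zero : ∀ l m, l < m → gramDet B (s l + s m) = 0 := by
    refine fun l m hlm => quadraticMap_eq_zero_of_sumsOfBasis s ?_
    rintro _ (⟨i, rfl⟩ | ⟨i, j, hij, rfl⟩)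
    · rw [gramDet_comm, basis_zero, zero_apply]
    · rcases eq_or_ne i l with rfl | hil
      · exact share j m i
      rcases eq_or_ne i m with rfl | him
      · rw [add_comm (s l), share]
      rcases eq_or_ne j l with rfl | hjl
      · rw [add_comm (s i), share]
      rcases eq_or_ne j m with rfl | hjm
      · rw [add_comm (s i), add_comm (s l), share]
      rcases hil.lt_or_gt with hlt | hgt
      · exact h22 i j l m hij hlm hlt hjl hjm
      · rw [gramDet_comm, h22 l m i j hlm hij hgt him.symm hjm.symm]
  ext x
  rw [gramDet_comm]
  refine DFunLike.congr_fun (quadraticMap_eq_zero_of_sumsOfBasis s ?_ : gramDet B x = 0) y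
  rintro _ (⟨l, rfl⟩ | ⟨l, m, hlm, rfl⟩)
  · rw [gramDet_comm, basis_zero, zero_apply]
  · rw [gramDet_comm, sum_zero l m hlm, zero_apply]

end QuadraticMap

section PolarizedRelation

variable {k P A : Type*} [CommRing k] [CommRing P] [Algebra k P] [CommRing A] [Algebra k A]

/-- The symmetric bilinear map `(x, y) ↦ f(x y g)` on a submodule of an algebra. -/
def mulBilin (f : P →ₗ[k] A) (V : Submodule k P) (g : P) : LinearMap.BilinMap k V A :=
  ((LinearMap.mul k P).compr₂ (f ∘ₗ LinearMap.mulRight k g)).domRestrict₁₂ V V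

variable {f : P →ₗ[k] A}

theorem mulBilin_apply {V : Submodule k P} (g : P) (x y : V) :
    mulBilin f V g x y = f (x * y * g) := rfl

theorem gramDet_mulBilin {V : Submodule k P} (g : P) (x y : V) :
    gramDet (mulBilin f V g) y x = f (x * x * g) * f (y * y * g) - f (x * y * g) ^ 2 := by
  rw [gramDet_apply, mulBilin_apply, mulBilin_apply, mulBilin_apply, mulBilin_apply,
    mul_comm (y : P) x, sq]

/-- The minor `f(acu) f(bdu) - f(adu) f(bcu)` is quadratic in `u`, so on all of `U` it is controlled
by the values on `sumsOfBasis h`, and polarizing it in `u` gives the assertion. -/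
theorem polarized_relation_of_minors {U : Submodule k P} {q : ℕ} (h : Module.Basis (Fin q) k U)
    (a b c d : P)
    (minors : ∀ g ∈ sumsOfBasis h,
      f (a * c * g) * f (b * d * g) = f (a * d * g) * f (b * c * g))
    (u v : U) :
    f (a * c * u) * f (b * d * v) + f (a * c * v) * f (b * d * u) =
      f (a * d * u) * f (b * c * v) + f (a * d * v) * f (b * c * u) := by
  let mulMap (e : P) : U →ₗ[k] A := f ∘ₗ LinearMap.mulLeft k e ∘ₗ U.subtype
  let Φ : QuadraticMap k U A :=
    QuadraticMap.linMulLin (mulMap (a * c)) (mulMap (b * d)) -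
      QuadraticMap.linMulLin (mulMap (a * d)) (mulMap (b * c))
  have hΦ : Φ = 0 := quadraticMap_eq_zero_of_sumsOfBasis h fun g hg => sub_eq_zero.2 (minors g hg)
  have vanish : ∀ w : U, f (a * c * w) * f (b * d * w) = f (a * d * w) * f (b * c * w) :=
    fun w => sub_eq_zero.1 (DFunLike.congr_fun hΦ w)
  have huv := vanish (u + v)
  simp only [Submodule.coe_add, mul_add, map_add] at huv
  linear_combination huv - vanish u - vanish v

end PolarizedRelation

section Exchange

open Finsupp (single)

variable {ι : Type*}

theorem exists_eq_single_add {u : ι →₀ ℕ} {i : ι} (hi : u i ≠ 0) : ∃ v, u = single i 1 + v :=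
  exists_add_of_le (Finsupp.single_le_iff.2 (Nat.one_le_iff_ne_zero.2 hi))

theorem degree_single_one_add (i : ι) (u : ι →₀ ℕ) : (single i 1 + u).degree = u.degree + 1 := by
  rw [map_add, Finsupp.degree_single, add_comm]

theorem exists_eq_single_add_of_degree {u : ι →₀ ℕ} {r : ℕ} (hu : u.degree = r + 1) :
    ∃ i v, u = single i 1 + v ∧ v.degree = r := by
  have hne : u ≠ 0 := by rintro rfl; simp at hu
  obtain ⟨i, hi⟩ := Finsupp.ne_iff.1 hne
  obtain ⟨v, rfl⟩ := exists_eq_single_add hi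
  exact ⟨i, v, rfl, by simpa [degree_single_one_add] using hu⟩

theorem apply_add_swap_of_single {α : Type*} {e : ℕ} {E : (ι →₀ ℕ) → (ι →₀ ℕ) → α}
    (hE : ∀ (c d : ι) (u v : ι →₀ ℕ), u.degree = e → v.degree = e →
      E (single c 1 + u) (single d 1 + v) = E (single d 1 + u) (single c 1 + v))
    (r : ℕ) {u v w w' : ι →₀ ℕ} (hu : u.degree = r) (hv : v.degree = r)
    (hw : r + w.degree = e + 1) (hw' : r + w'.degree = e + 1) :
    E (u + w) (v + w') = E (v + w) (u + w') := by
  induction r generalizing u v w w' with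
  | zero => rw [(Finsupp.degree_eq_zero_iff u).1 hu, (Finsupp.degree_eq_zero_iff v).1 hv]
  | succ r ih =>
    obtain ⟨c, u, rfl, hu'⟩ := exists_eq_single_add_of_degree hu
    obtain ⟨d, v, rfl, hv'⟩ := exists_eq_single_add_of_degree hv
    calc E (single c 1 + u + w) (single d 1 + v + w')
        = E (single d 1 + (u + w)) (single c 1 + (v + w')) := by
          rw [add_assoc, add_assoc, hE] <;> rw [map_add] <;> omega
      _ = E (u + (single d 1 + w)) (v + (single c 1 + w')) := by
          rw [add_left_comm, add_left_comm (single c 1)]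
      _ = E (v + (single d 1 + w)) (u + (single c 1 + w')) := by
          refine ih hu' hv' ?_ ?_ <;> rw [degree_single_one_add] <;> omega
      _ = E (single d 1 + v + w) (single c 1 + u + w') := by
          rw [add_left_comm, add_left_comm u, add_assoc, add_assoc]

/-- The relations `Y(x_a u) Y(x_b v) = Y(x_b u) Y(x_a v)` between the values of `Y` on the monomials
of degree `d`, written in terms of exponents. -/
def ExchangeRelations {A : Type*} [Mul A] (d : ℕ) (Y : (ι →₀ ℕ) → A) : Prop :=
  ∀ (a b : ι) (u v : ι →₀ ℕ), u.degree + 1 = d → v.degree + 1 = d →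
    Y (single a 1 + u) * Y (single b 1 + v) = Y (single b 1 + u) * Y (single a 1 + v)

/-- The difference `E(u, v)` of the two sides of an exchange relation is visibly antisymmetric;
the polarized relations say that `E` is symmetric under exchanging one variable between `u` and
`v`, hence symmetric. -/
theorem exchangeRelations_of_polarized {A : Type*} [CommRing A] (h2 : IsLeftRegular (2 : A))
    {r : ℕ} {Y : (ι →₀ ℕ) → A}
    (hY : ∀ (a b c d : ι) (u v : ι →₀ ℕ), u.degree = r → v.degree = r →
      Y (single a 1 + single c 1 + u) * Y (single b 1 + single d 1 + v) +
        Y (single a 1 + single c 1 + v) * Y (single b 1 + single d 1 + u) =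
      Y (single a 1 + single d 1 + u) * Y (single b 1 + single c 1 + v) +
        Y (single a 1 + single d 1 + v) * Y (single b 1 + single c 1 + u)) :
    ExchangeRelations (r + 2) Y := by
  intro a b u v hu hv
  let E (u v : ι →₀ ℕ) : A :=
    Y (single a 1 + u) * Y (single b 1 + v) - Y (single b 1 + u) * Y (single a 1 + v)
  have swap_single : ∀ (c d : ι) (u v : ι →₀ ℕ), u.degree = r → v.degree = r →
      E (single c 1 + u) (single d 1 + v) = E (single d 1 + u) (single c 1 + v) := by
    intro c d u v hu hv
    simp only [E, ← add_assoc]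
    linear_combination hY a b c d u v hu hv
  have symm : E u v = E v u := by
    simpa using apply_add_swap_of_single swap_single (r + 1) (w := 0) (w' := 0)
      (Nat.succ_injective hu) (Nat.succ_injective hv) (by simp) (by simp)
  have antisymm : E v u = -E u v := by simp only [E]; ring
  refine sub_eq_zero.1 (h2 ?_ : E u v = 0)
  linear_combination symm + antisymm

section Straightening

variable {A : Type*} [CommMonoid A] {d : ℕ} {Y : (ι →₀ ℕ) → A}

theorem exists_eq_single_add_cons {M : Multiset (ι →₀ ℕ)} {i : ι} (h : M.sum i ≠ 0) :
    ∃ v N, M = (single i 1 + v) ::ₘ N := by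
  obtain ⟨K, hK, hKi⟩ : ∃ K ∈ M, K i ≠ 0 := by
    by_contra! hzero
    apply h
    rw [← Finsupp.applyAddHom_apply, map_multiset_sum]
    exact Multiset.sum_eq_zero (by simpa using hzero)
  obtain ⟨v, rfl⟩ := exists_eq_single_add hKi
  exact ⟨v, Multiset.exists_cons_of_mem hK⟩

/-- A variable of `a` which is missing from a factor `J` occurs in another factor, and can be
exchanged with a variable of `J` which is not needed for `a`. -/
theorem ExchangeRelations.exists_le_mem_of_le_sum (hY : ExchangeRelations d Y)
    {M : Multiset (ι →₀ ℕ)} (hM : ∀ K ∈ M, K.degree = d) (hM0 : M ≠ 0) {a : ι →₀ ℕ}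
    (had : a.degree ≤ d) (ha : a ≤ M.sum) :
    ∃ J N, a ≤ J ∧ (∀ K ∈ J ::ₘ N, K.degree = d) ∧ (J ::ₘ N).sum = M.sum ∧
      ((J ::ₘ N).map Y).prod = (M.map Y).prod := by
  induction hr : a.degree generalizing a with
  | zero =>
    obtain ⟨J, hJ⟩ := Multiset.exists_mem_of_ne_zero hM0
    obtain ⟨N, rfl⟩ := Multiset.exists_cons_of_mem hJ
    exact ⟨J, N, by simp [(Finsupp.degree_eq_zero_iff a).1 hr], hM, rfl, rfl⟩
  | succ r ih =>
    obtain ⟨i, a, rfl, hdeg⟩ := exists_eq_single_add_of_degree hr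
    obtain ⟨J, N, haJ, hN, hsum, hprod⟩ := ih (by omega) (le_add_self.trans ha) hdeg
    obtain ⟨w, rfl⟩ := exists_add_of_le haJ
    rcases ne_or_eq (w i) 0 with hwi | hwi
    · obtain ⟨w, rfl⟩ := exists_eq_single_add hwi
      exact ⟨_, N, by rw [add_left_comm, ← add_assoc]; exact le_self_add, hN, hsum, hprod⟩
    obtain ⟨hJ, hN'⟩ := Multiset.forall_mem_cons.1 hN
    obtain ⟨v, N, rfl⟩ := exists_eq_single_add_cons (M := N) (i := i) fun hNi => by
      have := ha i
      simp only [← hsum, Multiset.sum_cons, Finsupp.add_apply, hwi, hNi, Finsupp.single_eq_same]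
        at this
      omega
    obtain ⟨hK, hN''⟩ := Multiset.forall_mem_cons.1 hN'
    rw [degree_single_one_add] at hK
    obtain ⟨j, w, rfl, hw⟩ : ∃ j w', w = single j 1 + w' ∧ w'.degree = d - (r + 1) :=
      exists_eq_single_add_of_degree (by rw [map_add] at hJ; omega)
    refine ⟨single i 1 + (a + w), (single j 1 + v) ::ₘ N, ?_, ?_, ?_, ?_⟩
    · rw [← add_assoc]
      exact le_self_add
    · simp only [Multiset.forall_mem_cons, degree_single_one_add]
      exact ⟨by rw [map_add]; omega, hK, hN''⟩
    · rw [← hsum]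
      simp only [Multiset.sum_cons]
      abel
    · rw [← hprod]
      simp only [Multiset.map_cons, Multiset.prod_cons, ← mul_assoc]
      rw [hY i j _ _ (by rw [map_add]; omega) hK, add_left_comm a]

theorem ExchangeRelations.prod_eq_of_sum_eq (hY : ExchangeRelations d Y) (hd : d ≠ 0)
    {M N : Multiset (ι →₀ ℕ)} (hM : ∀ K ∈ M, K.degree = d) (hN : ∀ K ∈ N, K.degree = d)
    (h : M.sum = N.sum) : (M.map Y).prod = (N.map Y).prod := by
  have sum_cons_ne_zero : ∀ (K : ι →₀ ℕ) (L : Multiset (ι →₀ ℕ)), K.degree = d →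
      (K ::ₘ L).sum ≠ 0 := by
    intro K L hK h0
    rw [Multiset.sum_cons, add_eq_zero] at h0
    simp [h0.1, hd.symm] at hK
  induction M using Multiset.induction_on generalizing N with
  | empty =>
    rcases Multiset.empty_or_exists_mem N with rfl | ⟨K, hK⟩
    · rfl
    · obtain ⟨N, rfl⟩ := Multiset.exists_cons_of_mem hK
      exact absurd h.symm (sum_cons_ne_zero K N (hN K hK))
  | cons I M ih =>
    obtain ⟨hI, hM⟩ := Multiset.forall_mem_cons.1 hM
    have hN0 : N ≠ 0 := by
      rintro rfl
      exact sum_cons_ne_zero I M hI h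
    obtain ⟨J, L, hIJ, hJL, hsum, hprod⟩ := hY.exists_le_mem_of_le_sum hN hN0 hI.le
      (by rw [← h, Multiset.sum_cons]; exact le_self_add)
    obtain ⟨hJ, hL⟩ := Multiset.forall_mem_cons.1 hJL
    obtain rfl : I = J := by
      obtain ⟨w, rfl⟩ := exists_add_of_le hIJ
      rw [map_add, hI, Nat.add_eq_left, Finsupp.degree_eq_zero_iff] at hJ
      rw [hJ, add_zero]
    have hML : M.sum = L.sum := by simpa using h.trans hsum.symm
    rw [← hprod, Multiset.map_cons, Multiset.map_cons, Multiset.prod_cons, Multiset.prod_cons,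
      ih hM hL hML]

end Straightening

end Exchange

@[to_additive]
theorem prod_map_toMultiset {σ M : Type*} [CommMonoid M] (g : σ → M) (m : σ →₀ ℕ) :
    (m.toMultiset.map g).prod = m.prod fun a c => g a ^ c := by
  induction m using Finsupp.induction_linear with
  | zero => simp
  | add m m' hm hm' =>
    rw [map_add, Multiset.map_add, Multiset.prod_add, hm, hm',
      Finsupp.prod_add_index' (by simp) fun a => pow_add (g a)]
  | single a c => simp [Multiset.map_nsmul, Multiset.prod_nsmul]

theorem aeval_monomial_monomial {R σ ι : Type*} [CommSemiring R] (e : σ → ι →₀ ℕ) (m : σ →₀ ℕ) :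
    aeval (fun I => monomial (e I) (1 : R)) (monomial m (1 : R)) =
      monomial (m.sum fun I c => c • e I) 1 := by
  simp only [aeval_def, eval₂_monomial, monomial_finsupp_sum_index, monomial_pow, one_pow, map_one]

/-- The linear map `φ` factors through the monomial map because the monomials of its source are a
basis on which `φ` only depends on the image exponent. -/
theorem map_eq_zero_of_aeval_monomial_eq_zero {R σ ι N : Type*} [CommSemiring R]
    [AddCommMonoid N] [Module R N] (e : σ → ι →₀ ℕ) (φ : MvPolynomial σ R →ₗ[R] N)
    (hφ : ∀ m m' : σ →₀ ℕ, (m.sum fun I c => c • e I) = (m'.sum fun I c => c • e I) →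
      φ (monomial m 1) = φ (monomial m' 1))
    {F : MvPolynomial σ R} (hF : aeval (fun I => monomial (e I) (1 : R)) F = 0) : φ F = 0 := by
  let value := Function.extend (fun m : σ →₀ ℕ => m.sum fun I c => c • e I)
    (fun m => φ (monomial m 1)) 0
  let ψ : MvPolynomial ι R →ₗ[R] N := (basisMonomials ι R).constr R value
  have hψ : ∀ a, ψ (monomial a 1) = value a := (basisMonomials ι R).constr_basis R value
  have factor : φ = ψ ∘ₗ (aeval fun I => monomial (e I) (1 : R)).toLinearMap := by
    refine (basisMonomials σ R).ext fun m => ?_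
    rw [coe_basisMonomials, LinearMap.comp_apply, AlgHom.toLinearMap_apply,
      aeval_monomial_monomial, hψ]
    exact (Function.FactorsThrough.extend_apply (fun m m' => hφ m m') 0 m).symm
  rw [factor, LinearMap.comp_apply, AlgHom.toLinearMap_apply, hF, map_zero]

section Veronese

variable {k : Type*} [Field k] {n d : ℕ}

/-- The homomorphism `z_I ↦ x^I` of homogeneous coordinate rings that corresponds to the Veronese
embedding. -/
noncomputable def veroneseHom (k : Type*) [Field k] (n d : ℕ) :
    MvPolynomial (Exponent n d) k →ₐ[k] MvPolynomial (Fin (n + 1)) k :=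
  aeval fun I => monomial I.1 1

theorem degree_exponent (I : Exponent n d) : I.1.degree = d := by
  rw [Finsupp.degree_eq_sum, I.2]

theorem ker_veroneseHom_le_ker {A : Type*} [CommRing A] [Algebra k A] (hd : d ≠ 0)
    (φ : MvPolynomial (Exponent n d) k →ₐ[k] A) {Y : (Fin (n + 1) →₀ ℕ) → A}
    (hφ : ∀ I, φ (X I) = Y I.1) (hY : ExchangeRelations d Y) :
    RingHom.ker (veroneseHom k n d) ≤ RingHom.ker φ := by
  have map_monomial : ∀ m : Exponent n d →₀ ℕ,
      φ (monomial m 1) = ((m.toMultiset.map Subtype.val).map Y).prod := fun m => by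
    rw [monomial_eq, C_1, one_mul, map_finsuppProd, Multiset.map_map, prod_map_toMultiset]
    simp only [map_pow, hφ, Function.comp_apply]
  have degree_eq : ∀ m : Exponent n d →₀ ℕ, ∀ K ∈ m.toMultiset.map Subtype.val,
      Finsupp.degree K = d := fun m K hK => by
    obtain ⟨I, -, rfl⟩ := Multiset.mem_map.1 hK
    exact degree_exponent I
  refine fun F hF => map_eq_zero_of_aeval_monomial_eq_zero Subtype.val φ.toLinearMap
    (fun m m' hmm' => ?_) hF
  rw [AlgHom.toLinearMap_apply, AlgHom.toLinearMap_apply, map_monomial, map_monomial]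
  refine hY.prod_eq_of_sum_eq hd (degree_eq m) (degree_eq m') ?_
  rw [sum_map_toMultiset, sum_map_toMultiset, hmm']

end Veronese

section Ideal

variable {k : Type*} [Field k] {n d : ℕ}

theorem eval_smul_of_isHomogeneous {σ : Type*} {F : MvPolynomial σ k} {m : ℕ}
    (hF : F.IsHomogeneous m) (c : k) (w : σ → k) : eval (c • w) F = c ^ m * eval w F := by
  rw [eval_eq, eval_eq, Finset.mul_sum]
  refine Finset.sum_congr rfl fun a ha => ?_
  have degree_eq : a.degree = m := by_contra fun h => mem_support_iff.1 ha (hF.coeff_eq_zero h)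
  simp only [Pi.smul_apply, smul_eq_mul, mul_pow, Finset.prod_mul_distrib,
    Finset.prod_pow_eq_pow_sum, ← Finsupp.degree_apply, degree_eq]
  ring

theorem eval_veroneseVector (v : Fin (n + 1) → k) (F : MvPolynomial (Exponent n d) k) :
    eval (veroneseVector k n d v) F = eval v (veroneseHom k n d F) := by
  suffices aeval (veroneseVector k n d v) = (aeval v).comp (veroneseHom k n d) from
    DFunLike.congr_fun this F
  ext I
  simp [veroneseHom, veroneseVector, eval_monomial, Finsupp.prod_fintype]

theorem homogeneousIdeal_veroneseVariety_le_ker [Infinite k] :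
    homogeneousIdeal (veroneseVariety k n d) ≤ RingHom.ker (veroneseHom k n d) := by
  refine Ideal.span_le.2 ?_
  rintro F ⟨m, -, hF⟩
  have vanish : X 0 * veroneseHom k n d F = 0 := MvPolynomial.funext fun v => by
    by_cases hv : v = 0
    · simp [hv]
    · rw [map_mul, ← eval_veroneseVector, hF _ (veroneseVector_ne_zero n d v hv)
        ⟨Projectivization.mk k v hv, rfl⟩, mul_zero, map_zero]
  exact (mul_eq_zero.1 vanish).resolve_left (X_ne_zero 0)

theorem mem_homogeneousIdeal_of_veroneseHom_eq_zero {F : MvPolynomial (Exponent n d) k} {m : ℕ}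
    (hF : F.IsHomogeneous m) (h0 : veroneseHom k n d F = 0) :
    F ∈ homogeneousIdeal (veroneseVariety k n d) := by
  refine Ideal.subset_span ⟨m, hF, ?_⟩
  rintro w hw ⟨P, hP⟩
  induction P using Projectivization.ind with
  | h v hv =>
    obtain ⟨c, rfl⟩ := (Projectivization.mk_eq_mk_iff' _ _ _ _ _).1 hP.symm
    rw [eval_smul_of_isHomogeneous hF, eval_veroneseVector, h0, map_zero, mul_zero]

theorem homogeneousIdeal_veroneseVariety_le_ker_of_exchangeRelations [Infinite k] {A : Type*}
    [CommRing A] [Algebra k A] (hd : d ≠ 0) (φ : MvPolynomial (Exponent n d) k →ₐ[k] A)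
    {Y : (Fin (n + 1) →₀ ℕ) → A} (hφ : ∀ I, φ (X I) = Y I.1) (hY : ExchangeRelations d Y) :
    homogeneousIdeal (veroneseVariety k n d) ≤ RingHom.ker φ :=
  homogeneousIdeal_veroneseVariety_le_ker.trans (ker_veroneseHom_le_ker hd φ hφ hY)

end Ideal

section LinearForm

variable {k : Type*} [Field k] {n d : ℕ}

/-- The map `linearForm` as a linear map. -/
noncomputable def linearFormMap (k : Type*) [Field k] (n d : ℕ) :
    MvPolynomial (Fin (n + 1)) k →ₗ[k] MvPolynomial (Exponent n d) k where
  toFun := linearForm n d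
  map_add' F G := by simp [linearForm, add_mul, Finset.sum_add_distrib]
  map_smul' c F := by simp [linearForm, mul_assoc, Finset.smul_sum, smul_eq_C_mul]

theorem linearForm_monomial (I : Exponent n d) :
    linearForm n d (monomial I.1 (1 : k)) = X I := by
  classical
  simp [linearForm, coeff_monomial, Subtype.coe_inj]

theorem isHomogeneous_linearForm (F : MvPolynomial (Fin (n + 1)) k) :
    (linearForm n d F).IsHomogeneous 1 :=
  IsHomogeneous.sum _ _ _ fun I _ => isHomogeneous_C_mul_X (F.coeff I.1) I

theorem veroneseHom_linearForm {F : MvPolynomial (Fin (n + 1)) k} (hF : F.IsHomogeneous d) :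
    veroneseHom k n d (linearForm n d F) = F := by
  classical
  ext a
  simp only [linearForm, map_sum, map_mul, veroneseHom, aeval_C, aeval_X, algebraMap_eq,
    coeff_sum, coeff_C_mul, coeff_monomial]
  by_cases ha : a.degree = d
  · have (I : Exponent n d) : I.1 = a ↔ I = ⟨a, by rw [← ha, Finsupp.degree_eq_sum]⟩ :=
      (Subtype.ext_iff (a2 := ⟨a, _⟩)).symm
    simp [this]
  · rw [hF.coeff_eq_zero ha]
    refine Finset.sum_eq_zero fun I _ => ?_
    rw [if_neg, mul_zero]
    rintro rfl
    exact ha (degree_exponent I)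

theorem isHomogeneous_mul_mul (hd : 2 ≤ d) {s t h : MvPolynomial (Fin (n + 1)) k}
    (hs : s.IsHomogeneous 1) (ht : t.IsHomogeneous 1) (hh : h.IsHomogeneous (d - 2)) :
    (s * t * h).IsHomogeneous d := by
  have := (hs.mul ht).mul hh
  rwa [show 1 + 1 + (d - 2) = d by omega] at this

theorem isHomogeneous_Q (s t h : MvPolynomial (Fin (n + 1)) k) : (Q n d s t h).IsHomogeneous 2 :=
  ((isHomogeneous_linearForm _).mul (isHomogeneous_linearForm _)).sub
    ((isHomogeneous_linearForm _).pow 2)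

theorem Q_mem_homogeneousIdeal (hd : 2 ≤ d) {s t h : MvPolynomial (Fin (n + 1)) k}
    (hs : s.IsHomogeneous 1) (ht : t.IsHomogeneous 1) (hh : h.IsHomogeneous (d - 2)) :
    Q n d s t h ∈ homogeneousIdeal (veroneseVariety k n d) := by
  refine mem_homogeneousIdeal_of_veroneseHom_eq_zero (isHomogeneous_Q s t h) ?_
  rw [Q, map_sub, map_mul, map_pow, veroneseHom_linearForm (isHomogeneous_mul_mul hd hs hs hh),
    veroneseHom_linearForm (isHomogeneous_mul_mul hd ht ht hh),
    veroneseHom_linearForm (isHomogeneous_mul_mul hd hs ht hh)]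
  ring

end LinearForm

section Rank

variable {k : Type*} [Field k] {n d : ℕ}

/-- The quadratic form `∑ i j, M i j * z_i * z_j` attached to a matrix `M`. -/
noncomputable def quadraticForm {R σ : Type*} [CommSemiring R] [Fintype σ] (M : Matrix σ σ R) :
    MvPolynomial σ R :=
  X ⬝ᵥ M.map C *ᵥ X

theorem coeff_quadraticForm {R σ : Type*} [CommSemiring R] [Fintype σ] [DecidableEq σ]
    (M : Matrix σ σ R) (i j : σ) :
    coeff (Finsupp.single i 1 + Finsupp.single j 1) (quadraticForm M) =
      if i = j then M i j else M i j + M j i := by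
  have term (a b : σ) : coeff (Finsupp.single i 1 + Finsupp.single j 1)
      (X a * (C (M a b) * X b)) = if a = i ∧ b = j ∨ a = j ∧ b = i then M a b else 0 := by
    simp [X, mul_left_comm (monomial _ _), monomial_mul, coeff_monomial,
      Finsupp.single_add_single_eq_single_add_single one_ne_zero one_ne_zero]
  simp only [quadraticForm, dotProduct, Matrix.mulVec, Matrix.map_apply, Finset.mul_sum, coeff_sum,
    term]
  split_ifs with hij
  · simp [hij, ite_and]
  · have split (a b : σ) : (if a = i ∧ b = j ∨ a = j ∧ b = i then M a b else 0) =
        (if a = i then if b = j then M a b else 0 else 0) +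
          if a = j then if b = i then M a b else 0 else 0 := by
      rcases eq_or_ne a i with rfl | hai
      · simp [hij]
      · simp [hai, ite_and]
    simp [split, Finset.sum_add_distrib]

theorem gramMatrix_quadraticForm {σ : Type*} [Fintype σ] (h2 : (2 : k) ≠ 0) {M : Matrix σ σ k}
    (hM : M.IsSymm) : gramMatrix (quadraticForm M) = M := by
  classical
  ext i j
  rw [gramMatrix, Matrix.of_apply]
  rcases eq_or_ne i j with rfl | hij
  · rw [if_pos rfl, ← one_add_one_eq_two, Finsupp.single_add, coeff_quadraticForm, if_pos rfl]
  · rw [if_neg hij, coeff_quadraticForm, if_neg hij, hM.apply, ← two_mul,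
      mul_div_cancel_left₀ _ h2]

theorem quadraticForm_transpose_mul_mul {R σ τ : Type*} [CommSemiring R] [Fintype σ] [Fintype τ]
    (P : Matrix τ σ R) (B : Matrix τ τ R) :
    quadraticForm (Pᵀ * (B * P)) = (P.map C *ᵥ X) ⬝ᵥ B.map C *ᵥ P.map C *ᵥ X := by
  rw [quadraticForm, Matrix.map_mul, Matrix.map_mul, ← Matrix.mulVec_mulVec,
    ← Matrix.mulVec_mulVec, Matrix.transpose_map, Matrix.dotProduct_mulVec,
    Matrix.vecMul_transpose]

theorem rank_transpose_mul_mul {σ τ : Type*} [Fintype σ] [Fintype τ] {P : Matrix τ σ k}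
    (hP : LinearIndependent k P.row) (B : Matrix τ τ k) :
    (Pᵀ * (B * P)).rank = B.rank := by
  classical
  obtain ⟨R, hR⟩ : ∃ R : Matrix σ τ k, P * R = 1 := by
    rw [← Matrix.mulVec_surjective_iff_exists_right_inverse]
    refine (LinearMap.range_eq_top (f := P.mulVecLin)).1 (Submodule.eq_top_of_finrank_eq ?_)
    rw [Module.finrank_fintype_fun_eq_card, ← hP.rank_matrix, Matrix.rank]
  have recover : Rᵀ * (Pᵀ * (B * P) * R) = B := by
    rw [Matrix.mul_assoc, Matrix.mul_assoc B, hR, Matrix.mul_one, ← Matrix.mul_assoc,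
      ← Matrix.transpose_mul, hR, Matrix.transpose_one, Matrix.one_mul]
  refine ((Matrix.rank_mul_le_right _ _).trans (Matrix.rank_mul_le_left _ _)).antisymm ?_
  calc B.rank = (Rᵀ * (Pᵀ * (B * P) * R)).rank := by rw [recover]
    _ ≤ _ := (Matrix.rank_mul_le_right _ _).trans (Matrix.rank_mul_le_left _ _)

/-- The symmetric matrix of the ternary quadratic form `x z - y²`. -/
def conicMatrix (k : Type*) [Field k] : Matrix (Fin 3) (Fin 3) k :=
  !![0, 0, 2⁻¹; 0, -1, 0; 2⁻¹, 0, 0]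

theorem isSymm_conicMatrix : (conicMatrix k).IsSymm := by
  ext i j
  fin_cases i <;> fin_cases j <;> rfl

theorem rank_conicMatrix (h2 : (2 : k) ≠ 0) : (conicMatrix k).rank = 3 := by
  rw [Matrix.rank_of_isUnit, Fintype.card_fin]
  rw [Matrix.isUnit_iff_isUnit_det, isUnit_iff_ne_zero, conicMatrix, Matrix.det_fin_three]
  simp [h2]

/-- The coefficients of the forms of degree `d` in a family: the rows are the linear forms on `ℙᴺ`
which `linearForm` assigns to its members. -/
def coeffMatrix {τ : Type*} (n d : ℕ) (F : τ → MvPolynomial (Fin (n + 1)) k) :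
    Matrix τ (Exponent n d) k :=
  Matrix.of fun i I => (F i).coeff I.1

theorem coeffMatrix_mulVec_X {τ : Type*} (F : τ → MvPolynomial (Fin (n + 1)) k) :
    (coeffMatrix n d F).map C *ᵥ X = fun i => linearForm n d (F i) := rfl

theorem linearIndependent_coeffMatrix {τ : Type*} {F : τ → MvPolynomial (Fin (n + 1)) k}
    (hF : ∀ i, (F i).IsHomogeneous d) (hli : LinearIndependent k F) :
    LinearIndependent k (coeffMatrix n d F).row := by
  let restrict : (Exponent n d → k) →ₗ[k] MvPolynomial (Fin (n + 1)) k :=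
    (veroneseHom k n d).toLinearMap ∘ₗ Fintype.linearCombination k X
  have restrict_row : restrict ∘ (coeffMatrix n d F).row = F := funext fun i => by
    conv_rhs => rw [← veroneseHom_linearForm (hF i)]
    simp [restrict, Fintype.linearCombination_apply, linearForm, smul_eq_C_mul, coeffMatrix]
  refine LinearIndependent.of_comp restrict ?_
  rwa [restrict_row]

theorem Q_eq_quadraticForm (h2 : (2 : k) ≠ 0) (s t h : MvPolynomial (Fin (n + 1)) k) :
    let P := coeffMatrix n d ![s * s * h, s * t * h, t * t * h]
    Q n d s t h = quadraticForm (Pᵀ * (conicMatrix k * P)) := by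
  have half : (C 2⁻¹ : MvPolynomial (Exponent n d) k) * 2 = 1 := by
    rw [← map_ofNat C 2, ← C_mul, inv_mul_cancel₀ h2, C_1]
  simp only [quadraticForm_transpose_mul_mul, coeffMatrix_mulVec_X]
  simp only [Q, conicMatrix, dotProduct, Matrix.mulVec, Matrix.map_apply, Matrix.of_apply,
    Matrix.cons_val', Matrix.cons_val_fin_one, Matrix.cons_val_zero, Matrix.cons_val_one,
    Matrix.cons_val, Fin.sum_univ_three, map_zero, map_neg, map_one]
  linear_combination -linearForm n d (s * s * h) * linearForm n d (t * t * h) * half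

theorem exists_eval_eq {σ τ : Type*} [Finite τ] {F : τ → MvPolynomial σ k}
    (hF : ∀ i, (F i).IsHomogeneous 1) (hli : LinearIndependent k F) (y : τ → k) :
    ∃ v, ∀ i, eval v (F i) = y i := by
  classical
  cases nonempty_fintype τ
  obtain ⟨g, hg⟩ := (Fintype.linearCombination k F).exists_leftInverse_of_injective
    (LinearMap.ker_eq_bot.2 hli.fintypeLinearCombination_injective)
  let φ : MvPolynomial σ k →ₗ[k] k := Fintype.linearCombination k y ∘ₗ g
  have hφ (i : τ) : φ (F i) = y i := by
    have : g (F i) = Pi.single i 1 := by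
      simpa using LinearMap.congr_fun hg (Pi.single i 1)
    simp [φ, this]
  refine ⟨fun a => φ (X a), fun i => (?_ : _ = φ (F i)).trans (hφ i)⟩
  have hmem := (mem_homogeneousSubmodule 1 (F i)).2 (hF i)
  rw [homogeneousSubmodule_one_eq_span_X] at hmem
  refine LinearMap.eqOn_span (f := (aeval fun a => φ (X a)).toLinearMap) ?_ hmem
  rintro _ ⟨a, rfl⟩
  simp

theorem linearIndependent_mul_self_mul {σ : Type*} {s t h : MvPolynomial σ k}
    (hs : s.IsHomogeneous 1) (ht : t.IsHomogeneous 1) (hst : LinearIndependent k ![s, t])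
    (h0 : h ≠ 0) : LinearIndependent k ![s * s * h, s * t * h, t * t * h] := by
  rw [Fintype.linearIndependent_iff]
  intro c hc
  have relation : c 0 • (s * s) + c 1 • (s * t) + c 2 • (t * t) = 0 := by
    refine (mul_eq_zero.1 ?_).resolve_right h0
    simpa [Fin.sum_univ_three, add_mul] using hc
  have eval_relation (x y : k) : c 0 * (x * x) + c 1 * (x * y) + c 2 * (y * y) = 0 := by
    obtain ⟨v, hv⟩ := exists_eval_eq (by simp [Fin.forall_fin_two, hs, ht]) hst ![x, y]
    obtain ⟨rfl, rfl⟩ : eval v s = x ∧ eval v t = y := ⟨hv 0, hv 1⟩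
    simpa [smul_eval] using congrArg (eval v) relation
  have hc0 : c 0 = 0 := by simpa using eval_relation 1 0
  have hc2 : c 2 = 0 := by simpa using eval_relation 0 1
  have hc1 : c 1 = 0 := by simpa [hc0, hc2] using eval_relation 1 1
  simp [Fin.forall_fin_succ, hc0, hc1, hc2]

theorem quadricRank_Q (h2 : (2 : k) ≠ 0) (hd : 2 ≤ d) {s t h : MvPolynomial (Fin (n + 1)) k}
    (hs : s.IsHomogeneous 1) (ht : t.IsHomogeneous 1) (hh : h.IsHomogeneous (d - 2))
    (hst : LinearIndependent k ![s, t]) (h0 : h ≠ 0) : quadricRank (Q n d s t h) = 3 := by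
  have independent := linearIndependent_mul_self_mul hs ht hst h0
  have homogeneous : ∀ i, (![s * s * h, s * t * h, t * t * h] i).IsHomogeneous d := by
    simp [Fin.forall_fin_succ, isHomogeneous_mul_mul hd, hs, ht, hh]
  rw [quadricRank, Q_eq_quadraticForm h2, gramMatrix_quadraticForm h2,
    rank_transpose_mul_mul (linearIndependent_coeffMatrix homogeneous independent),
    rank_conicMatrix h2]
  rw [Matrix.IsSymm, Matrix.transpose_mul, Matrix.transpose_mul, Matrix.transpose_transpose,
    isSymm_conicMatrix, Matrix.mul_assoc]

theorem isQuadric_Q (h2 : (2 : k) ≠ 0) (hd : 2 ≤ d) {s t h : MvPolynomial (Fin (n + 1)) k}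
    (hs : s.IsHomogeneous 1) (ht : t.IsHomogeneous 1) (hh : h.IsHomogeneous (d - 2))
    (hst : LinearIndependent k ![s, t]) (h0 : h ≠ 0) : IsQuadric (Q n d s t h) := by
  refine ⟨fun hQ => ?_, isHomogeneous_Q s t h⟩
  have gramMatrix_zero : gramMatrix (0 : MvPolynomial (Exponent n d) k) = 0 := by
    ext
    simp [gramMatrix]
  have rank_Q := quadricRank_Q h2 hd hs ht hh hst h0
  rw [hQ, quadricRank, gramMatrix_zero, Matrix.rank_zero] at rank_Q
  omega

end Rank

section Gamma

variable {k : Type*} [Field k] {n d : ℕ}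

theorem finite_sumsOfBasis {R : Type*} [Add R] {q : ℕ} (h : Fin q → R) :
    (sumsOfBasis h).Finite := by
  refine ((Set.finite_range h).union
    (Set.finite_range fun x : Fin q × Fin q => h x.1 + h x.2)).subset ?_
  rintro g (⟨i, rfl⟩ | ⟨i, j, -, rfl⟩)
  · exact Or.inl ⟨i, rfl⟩
  · exact Or.inr ⟨(i, j), rfl⟩

theorem ne_zero_of_mem_sumsOfBasis {R V : Type*} [Ring R] [Nontrivial R] [AddCommGroup V]
    [Module R V] {q : ℕ} (h : Module.Basis (Fin q) R V) {g : V} (hg : g ∈ sumsOfBasis h) :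
    g ≠ 0 := by
  rcases hg with ⟨i, rfl⟩ | ⟨i, j, hij, rfl⟩
  · exact h.ne_zero i
  · intro h0
    have coord_i := congrArg (fun v => h.repr v i) h0
    simp [hij.ne'] at coord_i

theorem mem_sumsOfBasis_coe {R V : Type*} [Semiring R] [AddCommMonoid V] [Module R V]
    {W : Submodule R V} {q : ℕ} {h : Fin q → W} {g : V} :
    g ∈ sumsOfBasis (fun i => (h i : V)) ↔ ∃ w ∈ sumsOfBasis h, (w : V) = g := by
  constructor
  · rintro (⟨i, rfl⟩ | ⟨i, j, hij, rfl⟩)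
    · exact ⟨h i, .inl ⟨i, rfl⟩, rfl⟩
    · exact ⟨h i + h j, .inr ⟨i, j, hij, rfl⟩, rfl⟩
  · rintro ⟨_, ⟨i, rfl⟩ | ⟨i, j, hij, rfl⟩, rfl⟩
    · exact .inl ⟨i, rfl⟩
    · exact .inr ⟨i, j, hij, rfl⟩

theorem linearIndependent_pair_of_repr {ι R V : Type*} [Ring R] [AddCommGroup V] [Module R V]
    (s : Module.Basis ι R V) {a b : V} {i j : ι} (hai : s.repr a i = 1) (hbi : s.repr b i = 0)
    (hbj : s.repr b j = 1) : LinearIndependent R ![a, b] := by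
  refine LinearIndependent.pair_iff.2 fun x y hxy => ?_
  have hx : x = 0 := by simpa [hai, hbi] using congrArg (fun v => s.repr v i) hxy
  have hy : y = 0 := by simpa [hx, hbj] using congrArg (fun v => s.repr v j) hxy
  exact ⟨hx, hy⟩

variable {p q : ℕ} (s : Module.Basis (Fin p) k (Forms k n 1))
  (h : Module.Basis (Fin q) k (Forms k n (d - 2)))

theorem exists_eq_Q_of_mem_Gamma {F : MvPolynomial (Exponent n d) k} (hF : F ∈ Gamma n d s h) :
    ∃ a ∈ sumsOfBasis s, ∃ b ∈ sumsOfBasis s, ∃ g ∈ sumsOfBasis h,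
      LinearIndependent k ![a, b] ∧ F = Q n d a.1 b.1 g.1 := by
  rcases hF with (⟨i, j, hij, g, hg, rfl⟩ | ⟨i, j, l, hij, hli, -, g, hg, rfl⟩) |
    ⟨i, j, l, m, hij, hlm, hil, -, -, g, hg, rfl⟩ <;>
      obtain ⟨g, hg', rfl⟩ := mem_sumsOfBasis_coe.1 hg
  · exact ⟨s i, .inl ⟨i, rfl⟩, s j, .inl ⟨j, rfl⟩, g, hg',
      linearIndependent_pair_of_repr s (i := i) (j := j) (by simp) (by simp [hij.ne]) (by simp),
      rfl⟩
  · exact ⟨s i + s j, .inr ⟨i, j, hij, rfl⟩, s l, .inl ⟨l, rfl⟩, g, hg',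
      linearIndependent_pair_of_repr s (i := i) (j := l) (by simp [hij.ne]) (by simp [hli.symm])
        (by simp), rfl⟩
  · exact ⟨s i + s j, .inr ⟨i, j, hij, rfl⟩, s l + s m, .inr ⟨l, m, hlm, rfl⟩, g, hg',
      linearIndependent_pair_of_repr s (i := i) (j := l) (by simp [hij.ne])
        (by simp [hil.ne, (hil.trans hlm).ne]) (by simp [hlm.ne]), rfl⟩

theorem finite_Gamma : (Gamma n d s h).Finite := by
  have hs := finite_sumsOfBasis s
  refine ((hs.prod (hs.prod (finite_sumsOfBasis h))).image
    fun x => Q n d x.1.1 x.2.1.1 x.2.2.1).subset fun F hF => ?_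
  obtain ⟨a, ha, b, hb, g, hg, -, rfl⟩ := exists_eq_Q_of_mem_Gamma s h hF
  exact ⟨(a, b, g), ⟨ha, hb, hg⟩, rfl⟩

theorem isQuadric_and_quadricRank_eq_of_mem_Gamma (h2 : (2 : k) ≠ 0) (hd : 2 ≤ d)
    {F : MvPolynomial (Exponent n d) k} (hF : F ∈ Gamma n d s h) :
    IsQuadric F ∧ quadricRank F = 3 := by
  obtain ⟨a, -, b, -, g, hg, hab, rfl⟩ := exists_eq_Q_of_mem_Gamma s h hF
  have g_ne_zero : g.1 ≠ 0 := fun h0 => ne_zero_of_mem_sumsOfBasis h hg (Subtype.ext h0)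
  have independent : LinearIndependent k ![a.1, b.1] := by
    rw [LinearIndependent.pair_iff] at hab ⊢
    exact fun x y hxy => hab x y (Subtype.ext hxy)
  exact ⟨isQuadric_Q h2 hd a.2 b.2 g.2 independent g_ne_zero,
    quadricRank_Q h2 hd a.2 b.2 g.2 independent g_ne_zero⟩

theorem span_Gamma_le (hd : 2 ≤ d) :
    Ideal.span (Gamma n d s h) ≤ homogeneousIdeal (veroneseVariety k n d) := by
  refine Ideal.span_le.2 fun F hF => ?_
  obtain ⟨a, -, b, -, g, -, -, rfl⟩ := exists_eq_Q_of_mem_Gamma s h hF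
  exact Q_mem_homogeneousIdeal hd a.2 b.2 g.2

end Gamma

section Generation

variable {k : Type*} [Field k] {n d : ℕ}

theorem isLeftRegular_ofNat {A : Type*} [CommRing A] [Algebra k A] {m : ℕ} [m.AtLeastTwo]
    (hm : (OfNat.ofNat m : k) ≠ 0) : IsLeftRegular (OfNat.ofNat m : A) := by
  have := ((isUnit_iff_ne_zero.2 hm).map (algebraMap k A)).isRegular.left
  rwa [map_ofNat] at this

variable {p q : ℕ} (s : Module.Basis (Fin p) k (Forms k n 1))
  (h : Module.Basis (Fin q) k (Forms k n (d - 2)))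

/-- The map `F ↦ f(F)` followed by reduction modulo the ideal generated by `Γ`. -/
noncomputable def linearFormModGamma :
    MvPolynomial (Fin (n + 1)) k →ₗ[k] MvPolynomial (Exponent n d) k ⧸ Ideal.span (Gamma n d s h) :=
  (Ideal.Quotient.mkₐ k _).toLinearMap ∘ₗ linearFormMap k n d

theorem linearFormModGamma_apply (F : MvPolynomial (Fin (n + 1)) k) :
    linearFormModGamma s h F = Ideal.Quotient.mkₐ k _ (linearForm n d F) := rfl

theorem gramDet_mulBilin_linearFormModGamma {x y : Forms k n 1} {g : MvPolynomial (Fin (n + 1)) k}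
    (hQ : Q n d x.1 y.1 g ∈ Gamma n d s h) :
    gramDet (mulBilin (linearFormModGamma s h) (Forms k n 1) g) y x = 0 := by
  rw [gramDet_mulBilin]
  simp only [linearFormModGamma_apply, ← map_mul, ← map_pow, ← map_sub]
  exact Ideal.Quotient.eq_zero_iff_mem.2 (Ideal.subset_span hQ)

theorem minors_linearFormModGamma (h2 : (2 : k) ≠ 0) (h3 : (3 : k) ≠ 0)
    (a b c e : Forms k n 1) {g : Forms k n (d - 2)} (hg : g ∈ sumsOfBasis h) :
    linearFormModGamma s h (a * c * g) * linearFormModGamma s h (b * e * g) =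
      linearFormModGamma s h (a * e * g) * linearFormModGamma s h (b * c * g) := by
  let B := mulBilin (linearFormModGamma s h) (Forms k n 1) g
  have hB : ∀ x y, B x y = B y x := fun x y => by
    simp only [B, mulBilin_apply, mul_comm x.1]
  have hg' : g.1 ∈ sumsOfBasis fun i => (h i).1 :=
    mem_sumsOfBasis_coe.2 ⟨g, hg, rfl⟩
  have gramDet_zero : ∀ y, gramDet B y = 0 := gramDet_eq_zero_of_basis s hB
    (fun i j hij => gramDet_mulBilin_linearFormModGamma s h (.inl (.inl ⟨i, j, hij, g, hg', rfl⟩)))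
    (fun i j l hij hli hlj => gramDet_mulBilin_linearFormModGamma s h
      (.inl (.inr ⟨i, j, l, hij, hli, hlj, g, hg', rfl⟩)))
    (fun i j l m hij hlm hil hjl hjm => gramDet_mulBilin_linearFormModGamma s h
      (.inr ⟨i, j, l, m, hij, hlm, hil, hjl, hjm, g, hg', rfl⟩))
  exact mul_eq_mul_of_gramDet_eq_zero (isLeftRegular_ofNat h2) (isLeftRegular_ofNat h3) hB
    gramDet_zero a b c e

theorem exchangeRelations_linearFormModGamma (h2 : (2 : k) ≠ 0) (h3 : (3 : k) ≠ 0) (hd : 2 ≤ d) :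
    ExchangeRelations d fun u => linearFormModGamma s h (monomial u 1) := by
  suffices relations : ExchangeRelations (d - 2 + 2)
      fun u => linearFormModGamma s h (monomial u 1) by
    intro a b u v hu hv
    exact relations a b u v (by omega) (by omega)
  refine exchangeRelations_of_polarized (isLeftRegular_ofNat h2) fun a b c e u v hu hv => ?_
  let x (i : Fin (n + 1)) : Forms k n 1 := ⟨X i, isHomogeneous_X k i⟩
  simpa [x, X, monomial_mul] using polarized_relation_of_minors h (x a) (x b) (x c) (x e)
    (fun _ => minors_linearFormModGamma s h h2 h3 _ _ _ _)
    ⟨monomial u 1, isHomogeneous_monomial 1 hu⟩ ⟨monomial v 1, isHomogeneous_monomial 1 hv⟩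

theorem span_Gamma_eq [Infinite k] (h2 : (2 : k) ≠ 0) (h3 : (3 : k) ≠ 0) (hd : 2 ≤ d) :
    Ideal.span (Gamma n d s h) = homogeneousIdeal (veroneseVariety k n d) := by
  refine (span_Gamma_le s h hd).antisymm ?_
  rw [← Ideal.Quotient.mkₐ_ker k (Ideal.span (Gamma n d s h))]
  refine homogeneousIdeal_veroneseVariety_le_ker_of_exchangeRelations (by omega) _ (fun I => ?_)
    (exchangeRelations_linearFormModGamma s h h2 h3 hd)
  rw [linearFormModGamma_apply, linearForm_monomial]

theorem homogeneousIdeal_veroneseVariety_one [Infinite k] :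
    homogeneousIdeal (veroneseVariety k n 1) = ⊥ := by
  refine le_bot_iff.1 ((homogeneousIdeal_veroneseVariety_le_ker_of_exchangeRelations one_ne_zero
    (AlgHom.id k _) (Y := fun u => linearForm n 1 (monomial u 1))
    (fun I => (linearForm_monomial I).symm) fun a b u v hu hv => ?_).trans fun F hF => hF)
  rw [(Finsupp.degree_eq_zero_iff u).1 (by omega), (Finsupp.degree_eq_zero_iff v).1 (by omega),
    mul_comm]

theorem propertyQR_veroneseVariety [Infinite k] (h2 : (2 : k) ≠ 0) (h3 : (3 : k) ≠ 0)
    (hd : 1 ≤ d) : PropertyQR 3 (veroneseVariety k n d) := by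
  rcases hd.eq_or_lt with rfl | hd
  · exact ⟨∅, by simp, by rw [homogeneousIdeal_veroneseVariety_one, Ideal.span_empty]⟩
  have finite_forms (e : ℕ) : Module.Finite k (Forms k n e) :=
    .of_fg (homogeneousSubmodule_fg _ k e)
  let s := Module.finBasis k (Forms k n 1)
  let h := Module.finBasis k (Forms k n (d - 2))
  refine ⟨Gamma n d s h, fun F hF => ?_, span_Gamma_eq s h h2 h3 hd⟩
  obtain ⟨quadric, rank_eq⟩ := isQuadric_and_quadricRank_eq_of_mem_Gamma s h h2 hd hF
  exact ⟨quadric, rank_eq.le⟩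

end Generation

end QuadricRank

open QuadricRank in
theorem theorem1p1_general {k : Type*} [Field k] [Infinite k] (h2 : ringChar k ≠ 2)
    (h3 : ringChar k ≠ 3) (n d : ℕ) (hd : 1 ≤ d) :
    PropertyQR 3 (veroneseVariety k n d) ∧
    (2 ≤ d → ∀ {p q : ℕ} (s : Module.Basis (Fin p) k (Forms k n 1))
      (h : Module.Basis (Fin q) k (Forms k n (d - 2))),
      (Gamma n d s h).Finite ∧
      (∀ F ∈ Gamma n d s h, IsQuadric F ∧ quadricRank F = 3) ∧
      Ideal.span (Gamma n d s h) = homogeneousIdeal (veroneseVariety k n d)) := by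
  have two_ne_zero : (2 : k) ≠ 0 := Ring.two_ne_zero h2
  have three_ne_zero : (3 : k) ≠ 0 := CharP.cast_ne_zero_of_ne_of_prime k Nat.prime_three h3
  exact ⟨propertyQR_veroneseVariety two_ne_zero three_ne_zero hd, fun hd _ _ s h =>
    ⟨finite_Gamma s h, fun _ => isQuadric_and_quadricRank_eq_of_mem_Gamma s h two_ne_zero hd,
      span_Gamma_eq s h two_ne_zero three_ne_zero hd⟩⟩

theorem theorem1p1 {k : Type*} [Field k] [IsAlgClosed k]
    (h2 : ringChar k ≠ 2) (h3 : ringChar k ≠ 3) (n d : ℕ) (hn : 1 ≤ n) (hd : 1 ≤ d) :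
    QuadricRank.PropertyQR 3 (QuadricRank.veroneseVariety k n d) ∧
    (2 ≤ d → ∀ {p q : ℕ} (s : Module.Basis (Fin p) k (QuadricRank.Forms k n 1))
      (h : Module.Basis (Fin q) k (QuadricRank.Forms k n (d - 2))),
      (QuadricRank.Gamma n d s h).Finite ∧
      (∀ F ∈ QuadricRank.Gamma n d s h,
        QuadricRank.IsQuadric F ∧ QuadricRank.quadricRank F = 3) ∧
      Ideal.span (QuadricRank.Gamma n d s h) =
        QuadricRank.homogeneousIdeal (QuadricRank.veroneseVariety k n d)) :=
  theorem1p1_general h2 h3 n d hd
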